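/- Let $n\ge 2$, $q_{12},q_{21}>0$, $\lambda_s>0$, $\lambda\ge 0$. A source evolves as a continuous-time Markov chain $Q(t)\in\{1,2\}$ with transition rates $q_{12}$ (from 1 to 2) and $q_{21}$ (from 2 to 1), and its version number $V_0(t)$ increases by one at each transition. Each node $i\in\{1,\dots,n\}$ stores a packet with version $V_i(t)$ and content $S_i(t)\in\{1,2\}$. The source sends its current packet $(V_0,Q)$ to each node at rate $\lambda_s/n$, and the packet is always accepted; for each ordered pair $i\ne j$, node $i$ sends its packet to node $j$ at rate $\lambda/(n-1)$, and node $j$ adopts it if and only if it is fresher, i.e. $V_i>V_j$. The network is the resulting continuous-time Markov chain, started from an arbitrary (possibly random) configuration in which version numbers identify packets: $V_i\le V_0$, nodes with equal versions have equal contents, and a node with $V_i=V_0$ has content $Q$. Let $X_i=V_0-V_i$ be the version age of node $i$ and $C_i(t)=\mathbf 1\{S_i(t)=Q(t)\}$ its accuracy; for a nonempty set $A$ of nodes let $C_A=\frac1{|A|}\sum_{i\in A}C_i$, and let $F_A$ be the accuracy $C_\ell$ of a node $\ell\in A$ of minimal version age in $A$ (all such nodes have the same accuracy). Then there are vectors $\mathbf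 f_2=[f_2^{(1)},f_2^{(2)}]^T$ and $\mathbf c=[c^{(1)},c^{(2)}]^T$, depending only on $n,q_{12},q_{21},\lambda_s,\lambda$, such that for $m\in\{1,2\}$ $$f_2^{(m)}=\lim_{t\to\infty}\mathbb E\big[F_A(t)\mathbf 1\{Q(t)=m\}\big]\quad\text{for every set } A \text{ of two nodes},$$ $$c^{(m)}=\lim_{t\to\infty}\mathbb E\big[C_A(t)\mathbf 1\{Q(t)=m\}\big]\quad\text{for every nonempty set } A \text{ of nodes},$$ and, with $\mu=\lambda_s/n$, $\pi_1=\frac{q_{21}}{q_{12}+q_{21}}$, $\pi_2=\frac{q_{12}}{q_{12}+q_{21}}$, the vector $\mathbf c$ is the unique solution of the linear system $$\bar W\,\mathbf c=\mathbf b+\lambda\,\mathbf f_2,\qquad \bar W=\begin{bmatrix} q_{12}+\mu+\lambda & q_{21}\\ q_{12} & q_{21}+\mu+\lambda\end{bmatrix},\qquad \mathbf b=\begin{bmatrix} q_{21}\pi_2+\mu\pi_1\\ q_{12}\pi_1+\mu\pi_2\end{bmatrix}.$$ Consequently, for every $k\in\{1,\dots,n\}$ and every set $A$ of $k$ nodes,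 the average accuracy $c_k=\lim_{t\to\infty}\mathbb E[C_A(t)]$ exists and equals $c=\mathbf 1^T\mathbf c=c^{(1)}+c^{(2)}$, independently of $k$ and of $A$. -/

import Mathlib

open MeasureTheory Filter Topology
open scoped NNReal BoundedContinuousFunction Matrix

namespace Gossip

/-- A configuration of the network: the source state (`0` and `1` are the states 1 and 2 of the
binary source), the version number of the source, and for every node the content and the version
number of the packet it stores. -/
structure State (n : ℕ) where
  source : Fin 2
  srcVersion : ℕ
  content : Fin n → Fin 2
  version : Fin n → ℕ

variable {n : ℕ}

instance : TopologicalSpace (State n) := ⊥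
instance : DiscreteTopology (State n) := ⟨rfl⟩
instance : MeasurableSpace (State n) := ⊤

namespace State

/-- Version age of node `i`. -/
def age (x : State n) (i : Fin n) : ℤ := (x.srcVersion : ℤ) - (x.version i : ℤ)

/-- A version number identifies a packet: no node is ahead of the source, nodes with equal versions
have equal contents, and a node with the current version has the current source state. -/
structure Consistent (x : State n) : Prop where
  age_nonneg : ∀ i, 0 ≤ x.age i
  content_eq : ∀ i j, x.age i = x.age j → x.content i = x.content j
  content_eq_source : ∀ i, x.age i = 0 → x.content i = x.source

/-- Accuracy `C_i` of node `i`. -/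
def accuracy (x : State n) (i : Fin n) : ℝ := if x.content i = x.source then 1 else 0

/-- Average accuracy `C_A` of a set of nodes. -/
noncomputable def avgAccuracy (A : Finset (Fin n)) (x : State n) : ℝ :=
  (∑ i ∈ A, x.accuracy i) / (A.card : ℝ)

open Classical in
/-- Freshness-based accuracy `F_A`: the accuracy of a node of minimal version age in `A`. In a
consistent configuration all such nodes have the same accuracy, see `freshAccuracy_eq`. -/
noncomputable def freshAccuracy (A : Finset (Fin n)) (x : State n) : ℝ :=
  if ∃ i ∈ A, (∀ j ∈ A, x.age i ≤ x.age j) ∧ x.content i = x.source then 1 else 0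

theorem freshAccuracy_eq {x : State n} (hx : x.Consistent) {A : Finset (Fin n)} {i : Fin n}
    (hi : i ∈ A) (hmin : ∀ j ∈ A, x.age i ≤ x.age j) :
    freshAccuracy A x = x.accuracy i := by
  unfold freshAccuracy accuracy
  congr 1
  refine propext ⟨?_, fun h => ⟨i, hi, hmin, h⟩⟩
  rintro ⟨k, hk, hkmin, hkc⟩
  rw [hx.content_eq i k (le_antisymm (hmin k hk) (hkmin i hi)), hkc]

/-- The indicator of `Q = m`. -/
def modeInd (m : Fin 2) (x : State n) : ℝ := if x.source = m then 1 else 0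

end State

/-- Events: the source transitions out of state `a`, the source pushes to node `j`, and node `i`
gossips to node `j ≠ i` (the pair is (sender, receiver)). -/
abbrev Event (n : ℕ) := Fin 2 ⊕ Fin n ⊕ {p : Fin n × Fin n // p.1 ≠ p.2}

/-- Rate of an event in a configuration. -/
noncomputable def rate (q12 q21 lamS lam : ℝ) : Event n → State n → ℝ
  | .inl a, x => if x.source = a then (if a = 0 then q12 else q21) else 0
  | .inr (.inl _), _ => lamS / (n : ℝ)
  | .inr (.inr _), _ => lam / ((n : ℝ) - 1)

/-- Configuration after an event: a source transition creates a new version at the source, a push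
is always accepted, a gossip packet is accepted if and only if it is fresher than the local one. -/
def reset : Event n → State n → State n
  | .inl a, x => { x with source := 1 - a, srcVersion := x.srcVersion + 1 }
  | .inr (.inl j), x =>
      { x with
        content := Function.update x.content j x.source
        version := Function.update x.version j x.srcVersion }
  | .inr (.inr p), x =>
      if x.version p.1.2 < x.version p.1.1 then
        { x with
          content := Function.update x.content p.1.2 (x.content p.1.1)
          version := Function.update x.version p.1.2 (x.version p.1.1) }
      else x

theorem rate_bounded (q12 q21 lamS lam : ℝ) (e : Event n) :
    ∃ K, ∀ x : State n, ‖rate q12 q21 lamS lam e x‖ ≤ K := by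
  rcases e with a | j | p
  · refine ⟨max ‖q12‖ ‖q21‖, fun x => ?_⟩
    simp only [rate]
    split_ifs <;> simp
  · exact ⟨‖lamS / (n : ℝ)‖, fun _ => le_rfl⟩
  · exact ⟨‖lam / ((n : ℝ) - 1)‖, fun _ => le_rfl⟩

/-- The rate of an event, as a bounded function of the configuration. -/
noncomputable def rateFn (q12 q21 lamS lam : ℝ) (e : Event n) : State n →ᵇ ℝ :=
  BoundedContinuousFunction.ofNormedAddCommGroup (rate q12 q21 lamS lam e)
    continuous_of_discreteTopology (rate_bounded q12 q21 lamS lam e).choose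
    (rate_bounded q12 q21 lamS lam e).choose_spec

/-- Composition with the reset map of an event. -/
noncomputable def resetOp (e : Event n) : (State n →ᵇ ℝ) →L[ℝ] (State n →ᵇ ℝ) :=
  LinearMap.mkContinuous
    { toFun := fun ψ => ψ.compContinuous ⟨reset e, continuous_of_discreteTopology⟩
      map_add' := fun _ _ => rfl
      map_smul' := fun _ _ => rfl }
    1 fun ψ => by
      rw [one_mul]
      exact (BoundedContinuousFunction.norm_le (norm_nonneg ψ)).2 fun x => ψ.norm_coe_le_norm _

/-- The generator of the network, a bounded operator on the bounded functions of the
configuration; see `generator_apply` for its explicit form. -/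
noncomputable def generator (n : ℕ) (q12 q21 lamS lam : ℝ) :
    (State n →ᵇ ℝ) →L[ℝ] (State n →ᵇ ℝ) :=
  ∑ e : Event n, (ContinuousLinearMap.mul ℝ (State n →ᵇ ℝ) (rateFn q12 q21 lamS lam e)).comp
    (resetOp e - ContinuousLinearMap.id ℝ (State n →ᵇ ℝ))

theorem generator_apply (q12 q21 lamS lam : ℝ) (ψ : State n →ᵇ ℝ) (x : State n) :
    generator n q12 q21 lamS lam ψ x =
      ∑ e : Event n, rate q12 q21 lamS lam e x * (ψ (reset e x) - ψ x) := by
  simp only [generator, _root_.sum_apply, BoundedContinuousFunction.sum_apply]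
  rfl

/-- The semigroup `exp (t L)` of a bounded operator `L` on a normed space. -/
noncomputable def expSemigroup {E : Type*} [NormedAddCommGroup E] [NormedSpace ℝ E]
    (L : E →L[ℝ] E) (t : ℝ) : E →L[ℝ] E :=
  NormedSpace.exp (t • L)

/-- The transition semigroup `exp (t L)` of the network. -/
noncomputable def semigroup (n : ℕ) (q12 q21 lamS lam : ℝ) (t : ℝ≥0) :
    (State n →ᵇ ℝ) →L[ℝ] (State n →ᵇ ℝ) :=
  expSemigroup (generator n q12 q21 lamS lam) (t : ℝ)

/-- `Z` is the configuration process of a gossip network on the probability space `(Ω, P)`: a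
continuous-time Markov chain, with respect to its own past, whose transition semigroup is
`exp (t L)`, started from a (possibly random) consistent configuration. -/
structure IsGossipProcess (q12 q21 lamS lam : ℝ) {Ω : Type*} [MeasurableSpace Ω]
    (P : Measure Ω) (Z : ℝ≥0 → Ω → State n) : Prop where
  measurable : ∀ t, Measurable (Z t)
  initial : ∀ᵐ ω ∂P, (Z 0 ω).Consistent
  markov : ∀ (s t : ℝ≥0) (ψ : State n →ᵇ ℝ),
    P[fun ω => ψ (Z (s + t) ω) | ⨆ u : Set.Iic s, MeasurableSpace.comap (Z u) ⊤]
      =ᵐ[P] fun ω => semigroup n q12 q21 lamS lam t ψ (Z s ω)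

/-- Stationary distribution of the binary source. -/
noncomputable def statDist (q12 q21 : ℝ) : Fin 2 → ℝ :=
  ![q21 / (q12 + q21), q12 / (q12 + q21)]

/-- The matrix of the linear system. -/
def Wbar (q12 q21 μ lam : ℝ) : Matrix (Fin 2) (Fin 2) ℝ :=
  !![q12 + μ + lam, q21; q12, q21 + μ + lam]

/-- The constant vector of the linear system. -/
noncomputable def bvec (q12 q21 μ : ℝ) : Fin 2 → ℝ :=
  ![q21 * statDist q12 q21 1 + μ * statDist q12 q21 0,
    q12 * statDist q12 q21 0 + μ * statDist q12 q21 1]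

end Gossip

/-!
The expectation of a bounded function `ψ` of the configuration at time `t` is
`u_ψ(t) = Φ (exp (t L) ψ)`, where `Φ` integrates against the initial law and `L` is the generator, so
`u_ψ' = u_{L ψ}`. As consistency is preserved by every event, only the values of `L ψ` on consistent
configurations matter (`Gossip.hasDerivAt_evolve`).

On consistent configurations the functions `F_A 1{Q = m}` satisfy a triangular system
(`Gossip.generator_freshModeFn`). A source transition replaces `F_A` by `1 - F_A` and switches the
mode; a push into `A`, at total rate `|A| lamS / n`, sets `F_A` to `1`; gossip from `i ∉ A` into `A`,
at rate `|A| lam / (n - 1)`, replaces `F_A` by `F_{A ∪ {i}}`; nothing else changes `F_A`. Given the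
limits for sets of `k + 1` nodes, the two modes for a set of `k` nodes thus solve a stable planar
linear equation with convergent forcing, and they tend to its equilibrium
(`tendsto_of_hasDerivAt_two_mode`, `Gossip.tendsto_evolve_freshModeFn`). Downward induction from the
whole network, which receives no outside gossip, gives limits depending on `k` alone
(`Gossip.exists_tendsto_evolve_freshModeFn`).

For `k = 1` the equilibrium equation is the stated system, `F_{{i}}` being the accuracy of node `i`;
averages over nodes then have the same limit. The system is uniquely solvable because
`det W = (μ + λ) (q12 + q21 + μ + λ) > 0`.
-/

/-! ### Linear relaxation equations -/

/-- The upper half of the relaxation limit: `exp (a t) (u t - M / a)` is eventually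
nonincreasing. -/
theorem eventually_le_of_hasDerivAt_relaxation {u g : ℝ → ℝ} {a M ε : ℝ} (ha : 0 < a)
    (hu : ∀ t, HasDerivAt u (-a * u t + g t) t) (hg : ∀ᶠ t in atTop, g t ≤ M) (hε : 0 < ε) :
    ∀ᶠ t in atTop, u t ≤ M / a + ε := by
  obtain ⟨T, hT⟩ := eventually_atTop.1 hg
  set h : ℝ → ℝ := fun t => Real.exp (a * t) * (u t - M / a) with hh
  have hd : ∀ t, HasDerivAt h (Real.exp (a * t) * (g t - M)) t := by
    intro t
    have h1 : HasDerivAt (fun t => Real.exp (a * t)) (Real.exp (a * t) * (a * 1)) t :=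
      ((hasDerivAt_id t).const_mul a).exp
    refine (h1.mul ((hu t).sub_const (M / a))).congr_deriv ?_
    field_simp
    ring
  have hanti : AntitoneOn h (Set.Ici T) := by
    refine antitoneOn_of_deriv_nonpos (convex_Ici T)
      (fun t _ => (hd t).continuousAt.continuousWithinAt)
      (fun t _ => (hd t).differentiableAt.differentiableWithinAt) fun t ht => ?_
    rw [interior_Ici] at ht
    rw [(hd t).deriv]
    exact mul_nonpos_of_nonneg_of_nonpos (Real.exp_pos _).le (sub_nonpos.2 (hT t (le_of_lt ht)))
  have hlim : Tendsto (fun t => h T * Real.exp (-(a * t))) atTop (𝓝 (h T * 0)) :=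
    (Real.tendsto_exp_neg_atTop_nhds_zero.comp (tendsto_id.const_mul_atTop ha)).const_mul _
  rw [mul_zero] at hlim
  filter_upwards [hlim.eventually (gt_mem_nhds hε), eventually_ge_atTop T] with t ht htT
  have h2 : h t ≤ h T := hanti Set.self_mem_Ici htT htT
  have h3 : h t * Real.exp (-(a * t)) = u t - M / a := by
    rw [hh, mul_right_comm, ← Real.exp_add, add_neg_cancel, Real.exp_zero, one_mul]
  have h4 := mul_le_mul_of_nonneg_right h2 (Real.exp_pos (-(a * t))).le
  linarith

/-- A solution of `u' = -a u + g` with `a > 0` and a convergent forcing `g` converges. -/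
theorem tendsto_of_hasDerivAt_relaxation {u g : ℝ → ℝ} {a G : ℝ} (ha : 0 < a)
    (hu : ∀ t, HasDerivAt u (-a * u t + g t) t) (hg : Tendsto g atTop (𝓝 G)) :
    Tendsto u atTop (𝓝 (G / a)) := by
  rw [Metric.tendsto_nhds]
  intro ε hε
  have hδ : 0 < a * (ε / 3) := by positivity
  have hup := eventually_le_of_hasDerivAt_relaxation ha hu
    (M := G + a * (ε / 3)) (hg.eventually (ge_mem_nhds (by linarith))) (ε := ε / 3) (by positivity)
  have hlow := eventually_le_of_hasDerivAt_relaxation (u := fun t => -u t) (g := fun t => -g t)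
    (M := -G + a * (ε / 3)) ha (fun t => (hu t).neg.congr_deriv (by ring))
    (hg.neg.eventually (ge_mem_nhds (by linarith))) (ε := ε / 3) (by positivity)
  filter_upwards [hup, hlow] with t h1 h2
  have e1 : (G + a * (ε / 3)) / a = G / a + ε / 3 := by field_simp
  have e2 : (-G + a * (ε / 3)) / a = -(G / a) + ε / 3 := by field_simp
  rw [Real.dist_eq, abs_lt]
  constructor <;> linarith

/-- The planar system `v' = -W v + g` with `W = !![a + κ, b; a, b + κ]` and a convergent forcing
`g` tends to its equilibrium. The row `(1, -1)` is a left eigenvector of `W`, so `v₀ - v₁` relaxes at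
rate `κ`, and then `v₀` alone relaxes at rate `a + b + κ`. -/
theorem tendsto_of_hasDerivAt_two_mode {v₀ v₁ g₀ g₁ : ℝ → ℝ} {a b κ G₀ G₁ f₀ f₁ : ℝ}
    (ha : 0 < a) (hb : 0 < b) (hκ : 0 < κ)
    (hv₀ : ∀ t, HasDerivAt v₀ (-(a + κ) * v₀ t - b * v₁ t + g₀ t) t)
    (hv₁ : ∀ t, HasDerivAt v₁ (-a * v₀ t - (b + κ) * v₁ t + g₁ t) t)
    (hg₀ : Tendsto g₀ atTop (𝓝 G₀)) (hg₁ : Tendsto g₁ atTop (𝓝 G₁))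
    (hf₀ : (a + κ) * f₀ + b * f₁ = G₀) (hf₁ : a * f₀ + (b + κ) * f₁ = G₁) :
    Tendsto v₀ atTop (𝓝 f₀) ∧ Tendsto v₁ atTop (𝓝 f₁) := by
  have hd : Tendsto (fun t => v₀ t - v₁ t) atTop (𝓝 (f₀ - f₁)) := by
    convert tendsto_of_hasDerivAt_relaxation (u := fun t => v₀ t - v₁ t)
      (g := fun t => g₀ t - g₁ t) hκ
      (fun t => ((hv₀ t).sub (hv₁ t)).congr_deriv (by ring)) (hg₀.sub hg₁) using 2
    rw [← hf₀, ← hf₁]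
    field_simp
    ring
  have h₀ : Tendsto v₀ atTop (𝓝 f₀) := by
    have hs : 0 < a + b + κ := by positivity
    convert tendsto_of_hasDerivAt_relaxation (u := v₀)
      (g := fun t => b * (v₀ t - v₁ t) + g₀ t) hs
      (fun t => (hv₀ t).congr_deriv (by ring)) ((hd.const_mul b).add hg₀) using 2
    rw [← hf₀]
    field_simp
    ring
  refine ⟨h₀, ?_⟩
  simpa using h₀.sub hd

namespace Gossip

variable {n : ℕ}

/-! ### Effect of the events on the freshness-based accuracy -/

theorem reset_gossip_of_le {x : State n} {p : {p : Fin n × Fin n // p.1 ≠ p.2}}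
    (h : x.version p.1.1 ≤ x.version p.1.2) : reset (.inr (.inr p)) x = x := by
  simp [reset, not_lt.2 h]

theorem reset_gossip_of_lt {x : State n} {p : {p : Fin n × Fin n // p.1 ≠ p.2}}
    (h : x.version p.1.2 < x.version p.1.1) :
    reset (.inr (.inr p)) x =
      { x with
        content := Function.update x.content p.1.2 (x.content p.1.1)
        version := Function.update x.version p.1.2 (x.version p.1.1) } := by
  simp [reset, h]

namespace State

theorem Consistent.reset {x : State n} (hx : x.Consistent) (e : Event n) :
    (reset e x).Consistent := by
  rcases e with a | j | p
  · have hage : ∀ i, (Gossip.reset (.inl a) x).age i = x.age i + 1 := fun i => by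
      simp only [Gossip.reset, age]; push_cast; ring
    refine ⟨fun i => ?_, fun i k h => ?_, fun i h => ?_⟩
    · have := hx.age_nonneg i; rw [hage]; omega
    · rw [hage, hage] at h
      exact hx.content_eq i k (by omega)
    · have := hx.age_nonneg i; rw [hage] at h; omega
  · have hage : ∀ i, (Gossip.reset (.inr (.inl j)) x).age i = if i = j then 0 else x.age i :=
      fun i => by
        by_cases h : i = j <;> simp [Gossip.reset, age, h]
    have hcon : ∀ i, (Gossip.reset (.inr (.inl j)) x).content i =
        if i = j then x.source else x.content i := fun i => by
      by_cases h : i = j <;> simp [Gossip.reset, h]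
    have hsrc : (Gossip.reset (.inr (.inl j)) x).source = x.source := rfl
    refine ⟨fun i => ?_, fun i k h => ?_, fun i h => ?_⟩
    · rw [hage]; split_ifs
      exacts [le_rfl, hx.age_nonneg i]
    · rw [hage, hage] at h
      rw [hcon, hcon]
      split_ifs at h ⊢
      · rfl
      · exact (hx.content_eq_source k h.symm).symm
      · exact hx.content_eq_source i h
      · exact hx.content_eq i k h
    · rw [hage] at h
      rw [hcon, hsrc]
      split_ifs at h ⊢
      · rfl
      · exact hx.content_eq_source i h
  · rcases le_or_gt (x.version p.1.1) (x.version p.1.2) with h | h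
    · rwa [reset_gossip_of_le h]
    · rw [reset_gossip_of_lt h]
      -- The receiver becomes a copy of the sender.
      set σ : Fin n → Fin n := fun i => if i = p.1.2 then p.1.1 else i with hσ
      have e1 : Function.update x.content p.1.2 (x.content p.1.1) = fun i => x.content (σ i) := by
        funext i; by_cases hi : i = p.1.2 <;> simp [hσ, hi]
      have e2 : Function.update x.version p.1.2 (x.version p.1.1) = fun i => x.version (σ i) := by
        funext i; by_cases hi : i = p.1.2 <;> simp [hσ, hi]
      rw [e1, e2]
      exact ⟨fun i => hx.age_nonneg (σ i), fun i k h => hx.content_eq (σ i) (σ k) h,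
        fun i h => hx.content_eq_source (σ i) h⟩

theorem age_le_age_iff {x : State n} {i j : Fin n} :
    x.age i ≤ x.age j ↔ x.version j ≤ x.version i := by
  unfold age; omega

theorem exists_freshest (x : State n) {A : Finset (Fin n)} (hA : A.Nonempty) :
    ∃ i ∈ A, ∀ j ∈ A, x.age i ≤ x.age j :=
  A.exists_min_image x.age hA

theorem freshAccuracy_singleton (x : State n) (i : Fin n) :
    freshAccuracy {i} x = x.accuracy i := by
  simp [freshAccuracy, accuracy]

/-- A source transition preserves the order of the ages and, the source being binary, turns every
inaccurate packet into an accurate one and conversely. -/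
theorem freshAccuracy_reset_source {x : State n} (hx : x.Consistent) {A : Finset (Fin n)}
    (hA : A.Nonempty) :
    freshAccuracy A (Gossip.reset (.inl x.source) x) = 1 - freshAccuracy A x := by
  obtain ⟨i, hi, hmin⟩ := x.exists_freshest hA
  rw [freshAccuracy_eq hx hi hmin, freshAccuracy_eq (hx.reset _) hi]
  · have key : ∀ c s : Fin 2, c = 1 - s ↔ ¬c = s := by decide
    have hiff : (Gossip.reset (.inl x.source) x).content i =
        (Gossip.reset (.inl x.source) x).source ↔ ¬x.content i = x.source := key _ _
    unfold accuracy
    by_cases h : x.content i = x.source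
    · rw [if_pos h, if_neg fun h' => hiff.1 h' h, sub_self]
    · rw [if_neg h, if_pos (hiff.2 h), sub_zero]
  · intro j hj
    have := hmin j hj
    rw [age_le_age_iff] at this ⊢
    exact this

theorem freshAccuracy_reset_push_of_mem {x : State n} (hx : x.Consistent) {A : Finset (Fin n)}
    {j : Fin n} (hj : j ∈ A) : freshAccuracy A (Gossip.reset (.inr (.inl j)) x) = 1 := by
  have h0 : (Gossip.reset (.inr (.inl j)) x).age j = 0 := by simp [Gossip.reset, age]
  rw [freshAccuracy_eq (hx.reset _) hj fun i _ => h0 ▸ (hx.reset _).age_nonneg i]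
  simp [accuracy, Gossip.reset]

/-- `F_A` only depends on the source state and the packets stored in `A`. -/
theorem freshAccuracy_congr {x y : State n} {A : Finset (Fin n)} (hs : x.source = y.source)
    (hA : ∀ i ∈ A, x.content i = y.content i ∧ x.version i = y.version i) :
    freshAccuracy A x = freshAccuracy A y := by
  unfold freshAccuracy
  congr 1
  refine propext (exists_congr fun i => and_congr_right fun hi => ?_)
  rw [hs, (hA i hi).1]
  refine and_congr_left fun _ => forall₂_congr fun j hj => ?_
  rw [age_le_age_iff, age_le_age_iff, (hA i hi).2, (hA j hj).2]

theorem freshAccuracy_reset_push_of_notMem {x : State n} {A : Finset (Fin n)}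
    {j : Fin n} (hj : j ∉ A) :
    freshAccuracy A (Gossip.reset (.inr (.inl j)) x) = freshAccuracy A x := by
  refine freshAccuracy_congr rfl fun i hi => ?_
  have : i ≠ j := fun h => hj (h ▸ hi)
  simp [Gossip.reset, this]

theorem freshAccuracy_reset_gossip_of_notMem {x : State n} {A : Finset (Fin n)}
    {p : {p : Fin n × Fin n // p.1 ≠ p.2}} (hp : p.1.2 ∉ A) :
    freshAccuracy A (Gossip.reset (.inr (.inr p)) x) = freshAccuracy A x := by
  rcases le_or_gt (x.version p.1.1) (x.version p.1.2) with h | h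
  · rw [reset_gossip_of_le h]
  · rw [reset_gossip_of_lt h]
    refine freshAccuracy_congr rfl fun i hi => ?_
    have : i ≠ p.1.2 := fun h => hp (h ▸ hi)
    simp [this]

/-- When a node of `A` receives a gossip packet, the freshest packet in `A` becomes the freshest one
among `A` and the sender, whether or not the packet is adopted and whether or not the sender lies
in `A`. This makes the equations for `F_A` close. -/
theorem freshAccuracy_reset_gossip_of_mem {x : State n} (hx : x.Consistent) {A : Finset (Fin n)}
    {p : {p : Fin n × Fin n // p.1 ≠ p.2}} (hp : p.1.2 ∈ A) :
    freshAccuracy A (Gossip.reset (.inr (.inr p)) x) = freshAccuracy (insert p.1.1 A) x := by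
  obtain ⟨i, hi, hmin⟩ := x.exists_freshest ⟨_, hp⟩
  have hy := hx.reset (.inr (.inr p))
  simp only [age_le_age_iff] at hmin
  rcases le_or_gt (x.version p.1.1) (x.version p.1.2) with h | h
  · rw [reset_gossip_of_le h, freshAccuracy_eq hx hi fun j hj => age_le_age_iff.2 (hmin j hj),
      freshAccuracy_eq hx (Finset.mem_insert_of_mem hi)]
    intro j hj
    rw [age_le_age_iff]
    rcases Finset.mem_insert.1 hj with rfl | hj
    exacts [h.trans (hmin _ hp), hmin j hj]
  · rw [reset_gossip_of_lt h] at hy ⊢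
    rcases le_or_gt (x.version i) (x.version p.1.1) with hle | hlt
    -- The sender is freshest in `insert p.1.1 A`, hence the receiver is freshest in `A` afterwards.
    · rw [freshAccuracy_eq hx (Finset.mem_insert_self _ _), freshAccuracy_eq hy hp]
      · simp [accuracy]
      · intro j hj
        rw [age_le_age_iff]
        by_cases hjr : j = p.1.2
        · rw [hjr]
        · simpa [hjr] using (hmin j hj).trans hle
      · intro j hj
        rw [age_le_age_iff]
        rcases Finset.mem_insert.1 hj with rfl | hj
        exacts [le_rfl, (hmin j hj).trans hle]
    · have hir : i ≠ p.1.2 := by rintro rfl; omega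
      rw [freshAccuracy_eq hx (Finset.mem_insert_of_mem hi), freshAccuracy_eq hy hi]
      · simp [accuracy, hir]
      · intro j hj
        rw [age_le_age_iff]
        by_cases hjr : j = p.1.2
        · simpa [hjr, hir] using hlt.le
        · simpa [hjr, hir] using hmin j hj
      · intro j hj
        rw [age_le_age_iff]
        rcases Finset.mem_insert.1 hj with rfl | hj
        exacts [hlt.le, hmin j hj]

/-! ### The generator on mode-tagged accuracies -/

theorem abs_modeInd_le (m : Fin 2) (x : State n) : |x.modeInd m| ≤ 1 := by
  unfold modeInd; split_ifs <;> simp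

theorem abs_freshAccuracy_le (A : Finset (Fin n)) (x : State n) : |freshAccuracy A x| ≤ 1 := by
  unfold freshAccuracy; split_ifs <;> simp

end State

/-- The indicator of `Q = m`, as a bounded function of the configuration. -/
noncomputable def modeFn (n : ℕ) (m : Fin 2) : State n →ᵇ ℝ :=
  BoundedContinuousFunction.ofNormedAddCommGroup (State.modeInd m) continuous_of_discreteTopology 1
    (State.abs_modeInd_le m)

/-- `F_A` on the event `Q = m`, as a bounded function of the configuration. -/
noncomputable def freshModeFn (A : Finset (Fin n)) (m : Fin 2) : State n →ᵇ ℝ :=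
  BoundedContinuousFunction.ofNormedAddCommGroup
    (fun x => State.freshAccuracy A x * State.modeInd m x) continuous_of_discreteTopology 1
    fun x => by
      rw [Real.norm_eq_abs, abs_mul]
      exact mul_le_one₀ (State.abs_freshAccuracy_le A x) (abs_nonneg _) (State.abs_modeInd_le m x)

theorem modeFn_apply (m : Fin 2) (x : State n) : modeFn n m x = x.modeInd m := rfl

theorem freshModeFn_apply (A : Finset (Fin n)) (m : Fin 2) (x : State n) :
    freshModeFn A m x = x.freshAccuracy A * x.modeInd m := rfl

theorem modeFn_zero_add_one : modeFn n 0 + modeFn n 1 = 1 := by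
  ext x
  change (if x.source = 0 then (1 : ℝ) else 0) + (if x.source = 1 then (1 : ℝ) else 0) = 1
  have : x.source = 0 ∨ x.source = 1 := by
    generalize x.source = s
    fin_cases s <;> simp
  rcases this with h | h <;> simp [h]

/-- The rate at which the source leaves state `a`. -/
def exitRate (q12 q21 : ℝ) (a : Fin 2) : ℝ := if a = 0 then q12 else q21

theorem sum_source_events (q12 q21 lamS lam : ℝ) (ψ : State n →ᵇ ℝ) (x : State n) :
    ∑ a : Fin 2, rate q12 q21 lamS lam (.inl a) x * (ψ (reset (.inl a) x) - ψ x) =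
      exitRate q12 q21 x.source * (ψ (reset (.inl x.source) x) - ψ x) := by
  rw [Finset.sum_eq_single x.source]
  · simp [rate, exitRate]
  · intro a _ ha
    simp [rate, Ne.symm ha]
  · simp

theorem generator_modeFn (q12 q21 lamS lam : ℝ) (m : Fin 2) :
    generator n q12 q21 lamS lam (modeFn n m) =
      exitRate q12 q21 (1 - m) • modeFn n (1 - m) - exitRate q12 q21 m • modeFn n m := by
  ext x
  rw [generator_apply, Fintype.sum_sum_type, Fintype.sum_sum_type, sum_source_events]
  have h1 : ∀ j, modeFn n m (reset (.inr (.inl j)) x) = modeFn n m x := fun _ => rfl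
  have h2 : ∀ p, modeFn n m (reset (.inr (.inr p)) x) = modeFn n m x := fun p => by
    simp only [reset]; split_ifs <;> rfl
  simp only [h1, h2, sub_self, mul_zero, Finset.sum_const_zero, add_zero]
  change _ * (State.modeInd m _ - State.modeInd m x) =
    exitRate q12 q21 (1 - m) * State.modeInd (1 - m) x - exitRate q12 q21 m * State.modeInd m x
  simp only [State.modeInd, reset]
  have : ∀ s m : Fin 2, exitRate q12 q21 s * ((if 1 - s = m then (1 : ℝ) else 0) -
      if s = m then 1 else 0) = exitRate q12 q21 (1 - m) * (if s = 1 - m then 1 else 0) -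
        exitRate q12 q21 m * if s = m then 1 else 0 := by
    intro s m
    fin_cases s <;> fin_cases m <;> simp
  exact this _ _

/-- The closed equation for `F_A` on `Q = m`: the generator only produces the same quantity in the
other mode, mode indicators, and the quantities for the sets with one more node. -/
theorem generator_freshModeFn (q12 q21 lamS lam : ℝ) {A : Finset (Fin n)} (hA : A.Nonempty)
    (m : Fin 2) {x : State n} (hx : x.Consistent) :
    generator n q12 q21 lamS lam (freshModeFn A m) x =
      (exitRate q12 q21 (1 - m) • (modeFn n (1 - m) - freshModeFn A (1 - m))
        - exitRate q12 q21 m • freshModeFn A m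
        + (A.card * (lamS / n)) • (modeFn n m - freshModeFn A m)
        + (A.card * (lam / (n - 1))) • ∑ i ∈ Aᶜ, (freshModeFn (insert i A) m - freshModeFn A m)
        : State n →ᵇ ℝ) x := by
  rw [generator_apply, Fintype.sum_sum_type, Fintype.sum_sum_type, sum_source_events, ← add_assoc]
  simp only [BoundedContinuousFunction.coe_add, BoundedContinuousFunction.coe_sub,
    BoundedContinuousFunction.coe_smul, BoundedContinuousFunction.coe_sum, Pi.add_apply,
    Pi.sub_apply, Finset.sum_apply, smul_eq_mul]
  congr 1
  · congr 1
    · simp only [freshModeFn_apply, modeFn_apply, State.freshAccuracy_reset_source hx hA]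
      simp only [State.modeInd, reset]
      have : ∀ (F : ℝ) (s m : Fin 2), exitRate q12 q21 s *
          ((1 - F) * (if 1 - s = m then (1 : ℝ) else 0) - F * if s = m then 1 else 0) =
          exitRate q12 q21 (1 - m) *
            ((if s = 1 - m then 1 else 0) - F * if s = 1 - m then 1 else 0) -
          exitRate q12 q21 m * (F * if s = m then 1 else 0) := by
        intro F s m
        fin_cases s <;> fin_cases m <;> simp
      exact this _ _ _
    · rw [← Finset.sum_subset (Finset.subset_univ A), Finset.sum_congr rfl, Finset.sum_const,
        nsmul_eq_mul, mul_assoc]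
      · intro j hj
        rw [freshModeFn_apply, freshModeFn_apply, State.freshAccuracy_reset_push_of_mem hx hj,
          one_mul]
        rfl
      · intro j _ hj
        rw [freshModeFn_apply, freshModeFn_apply, State.freshAccuracy_reset_push_of_notMem hj]
        exact mul_eq_zero_of_right _ (sub_self _)
  · set D : Fin n → ℝ := fun i => freshModeFn (insert i A) m x - freshModeFn A m x with hD
    have hD0 : ∀ i ∈ A, D i = 0 := fun i hi => by rw [hD]; simp [Finset.insert_eq_of_mem hi]
    have hterm : ∀ p : {p : Fin n × Fin n // p.1 ≠ p.2},
        rate q12 q21 lamS lam (.inr (.inr p)) x *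
          (freshModeFn A m (reset (.inr (.inr p)) x) - freshModeFn A m x) =
        if p.1.2 ∈ A then lam / (n - 1) * D p.1.1 else 0 := by
      intro p
      have hmode : State.modeInd m (reset (.inr (.inr p)) x) = State.modeInd m x := by
        simp only [reset]; split_ifs <;> rfl
      rw [hD, freshModeFn_apply, freshModeFn_apply, hmode]
      split_ifs with hp
      · rw [State.freshAccuracy_reset_gossip_of_mem hx hp]
        rfl
      · rw [State.freshAccuracy_reset_gossip_of_notMem hp, sub_self, mul_zero]
    rw [Finset.sum_congr rfl fun p _ => hterm p]
    -- The diagonal pairs excluded from the events contribute nothing.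
    have hdiag : ∑ p : {p : Fin n × Fin n // p.1 ≠ p.2},
        (if p.1.2 ∈ A then lam / (n - 1) * D p.1.1 else 0) =
        ∑ p : Fin n × Fin n, if p.2 ∈ A then lam / (n - 1) * D p.1 else 0 := by
      rw [← Finset.sum_subtype (p := fun p : Fin n × Fin n => p.1 ≠ p.2)
        (Finset.univ.filter fun p : Fin n × Fin n => p.1 ≠ p.2) (by simp)
        (fun p => if p.2 ∈ A then lam / (n - 1) * D p.1 else 0)]
      refine Finset.sum_subset (Finset.subset_univ _) fun p _ hp => ?_
      have hp : p.1 = p.2 := by simpa using hp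
      split_ifs with h
      · rw [hD0 _ (hp ▸ h), mul_zero]
      · rfl
    rw [hdiag, Fintype.sum_prod_type, mul_assoc, Finset.mul_sum, Finset.mul_sum,
      ← Finset.sum_subset (Finset.subset_univ Aᶜ)]
    · refine Finset.sum_congr rfl fun i _ => ?_
      change ∑ y, (if y ∈ A then lam / (n - 1) * D i else 0) =
        (A.card : ℝ) * (lam / (n - 1) * D i)
      rw [← Finset.sum_filter, Finset.sum_const, nsmul_eq_mul]
      simp
    · intro i _ hi
      change ∑ y, (if y ∈ A then lam / (n - 1) * D i else 0) = 0
      rw [hD0 i (by simpa using hi)]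
      simp

/-! ### Evolution of expectations -/

theorem hasDerivAt_expSemigroup {E : Type*} [NormedAddCommGroup E] [NormedSpace ℝ E]
    [CompleteSpace E] (L : E →L[ℝ] E) (Φ : E →L[ℝ] ℝ) (v : E) (t : ℝ) :
    HasDerivAt (fun s => Φ (expSemigroup L s v)) (Φ (expSemigroup L t (L v))) t := by
  have h1 : HasDerivAt (fun s : ℝ => NormedSpace.exp (s • L)) (NormedSpace.exp (t • L) * L) t :=
    hasDerivAt_exp_smul_const L t
  exact (Φ.comp (ContinuousLinearMap.apply ℝ E v)).hasFDerivAt.comp_hasDerivAt t h1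

/-- An abstract initial law: a bounded functional which is normalized and does not see functions
vanishing on all consistent configurations. -/
structure IsInitialLaw (Φ : (State n →ᵇ ℝ) →L[ℝ] ℝ) : Prop where
  map_one : Φ 1 = 1
  map_eq_zero : ∀ ψ : State n →ᵇ ℝ, (∀ x : State n, x.Consistent → ψ x = 0) → Φ ψ = 0

/-- The expectation of `ψ` at time `t` if the network starts from the law `Φ`. -/
noncomputable def evolve (q12 q21 lamS lam : ℝ) (Φ : (State n →ᵇ ℝ) →L[ℝ] ℝ) (ψ : State n →ᵇ ℝ)
    (t : ℝ) : ℝ :=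
  Φ (expSemigroup (generator n q12 q21 lamS lam) t ψ)

section Evolve

variable {q12 q21 lamS lam : ℝ} {Φ : (State n →ᵇ ℝ) →L[ℝ] ℝ}

theorem evolve_add (ψ χ : State n →ᵇ ℝ) (t : ℝ) :
    evolve q12 q21 lamS lam Φ (ψ + χ) t =
      evolve q12 q21 lamS lam Φ ψ t + evolve q12 q21 lamS lam Φ χ t := by
  simp [evolve]

theorem evolve_sub (ψ χ : State n →ᵇ ℝ) (t : ℝ) :
    evolve q12 q21 lamS lam Φ (ψ - χ) t =
      evolve q12 q21 lamS lam Φ ψ t - evolve q12 q21 lamS lam Φ χ t := by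
  simp [evolve]

theorem evolve_smul (r : ℝ) (ψ : State n →ᵇ ℝ) (t : ℝ) :
    evolve q12 q21 lamS lam Φ (r • ψ) t = r * evolve q12 q21 lamS lam Φ ψ t := by
  simp [evolve]

theorem evolve_sum {ι : Type*} (s : Finset ι) (ψ : ι → State n →ᵇ ℝ) (t : ℝ) :
    evolve q12 q21 lamS lam Φ (∑ i ∈ s, ψ i) t =
      ∑ i ∈ s, evolve q12 q21 lamS lam Φ (ψ i) t := by
  simp [evolve]

/-- Consistent configurations are closed under all events, hence the functions vanishing on them are
invariant under the powers of the generator and under its exponential series. -/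
theorem semigroup_apply_eq_zero {ψ : State n →ᵇ ℝ} (hψ : ∀ x : State n, x.Consistent → ψ x = 0)
    (t : ℝ) {x : State n} (hx : x.Consistent) :
    expSemigroup (generator n q12 q21 lamS lam) t ψ x = 0 := by
  set L := generator n q12 q21 lamS lam
  have hpow : ∀ (k : ℕ) (y : State n), y.Consistent → ((t • L) ^ k) ψ y = 0 := by
    intro k
    induction k with
    | zero => exact hψ
    | succ k ih =>
      intro y hy
      rw [pow_succ']
      change t * L (((t • L) ^ k) ψ) y = 0
      rw [generator_apply]
      simp only [ih _ hy, ih _ (hy.reset _), sub_self, mul_zero, Finset.sum_const_zero]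
  have hs := NormedSpace.exp_series_hasSum_exp' (𝕂 := ℝ) (t • L)
  have hs' := (hs.mapL (ContinuousLinearMap.apply ℝ (State n →ᵇ ℝ) ψ)).mapL
    (BoundedContinuousFunction.evalCLM ℝ x)
  have : ∀ k : ℕ, BoundedContinuousFunction.evalCLM ℝ x
      (ContinuousLinearMap.apply ℝ (State n →ᵇ ℝ) ψ ((k.factorial⁻¹ : ℝ) • (t • L) ^ k)) = 0 := by
    intro k
    change (k.factorial⁻¹ : ℝ) * ((t • L) ^ k) ψ x = 0
    rw [hpow k x hx, mul_zero]
  simp only [this] at hs'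
  exact hs'.unique hasSum_zero

/-- The evolution equation `d/dt E[ψ] = E[L ψ]`. Only the values of `L ψ` on consistent
configurations matter, because these are closed under the dynamics. -/
theorem hasDerivAt_evolve (hΦ : IsInitialLaw Φ) {ψ χ : State n →ᵇ ℝ}
    (h : ∀ x : State n, x.Consistent → generator n q12 q21 lamS lam ψ x = χ x) (t : ℝ) :
    HasDerivAt (evolve q12 q21 lamS lam Φ ψ) (evolve q12 q21 lamS lam Φ χ t) t := by
  refine (hasDerivAt_expSemigroup _ Φ ψ t).congr_deriv ?_
  have h2 : evolve q12 q21 lamS lam Φ (generator n q12 q21 lamS lam ψ - χ) t = 0 :=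
    hΦ.map_eq_zero _ fun x hx => semigroup_apply_eq_zero
      (fun y hy => sub_eq_zero.2 (h y hy)) t hx
  rw [evolve_sub, sub_eq_zero] at h2
  exact h2

theorem evolve_one (hΦ : IsInitialLaw Φ) (t : ℝ) : evolve q12 q21 lamS lam Φ 1 t = 1 := by
  have hd : ∀ s, HasDerivAt (evolve q12 q21 lamS lam Φ 1) 0 s := fun s => by
    refine (hasDerivAt_evolve hΦ (χ := 0) (fun x _ => ?_) s).congr_deriv (by simp [evolve])
    simp [generator_apply]
  rw [is_const_of_deriv_eq_zero (fun s => (hd s).differentiableAt) (fun s => (hd s).deriv) t 0]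
  simp [evolve, expSemigroup, hΦ.map_one]

theorem tendsto_evolve_modeFn (hq12 : 0 < q12) (hq21 : 0 < q21) (hΦ : IsInitialLaw Φ)
    (m : Fin 2) :
    Tendsto (evolve q12 q21 lamS lam Φ (modeFn n m)) atTop (𝓝 (statDist q12 q21 m)) := by
  have hsum : ∀ t, evolve q12 q21 lamS lam Φ (modeFn n 1) t =
      1 - evolve q12 q21 lamS lam Φ (modeFn n 0) t := fun t => by
    rw [← evolve_one hΦ (q12 := q12) (q21 := q21) (lamS := lamS) (lam := lam) t,
      ← modeFn_zero_add_one, evolve_add]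
    ring
  have h0 : Tendsto (evolve q12 q21 lamS lam Φ (modeFn n 0)) atTop (𝓝 (q21 / (q12 + q21))) := by
    refine tendsto_of_hasDerivAt_relaxation (g := fun _ => q21) (by positivity) (fun t => ?_)
      tendsto_const_nhds
    refine (hasDerivAt_evolve hΦ (fun x _ => by rw [generator_modeFn]) t).congr_deriv ?_
    rw [evolve_sub, evolve_smul, evolve_smul, sub_zero, hsum]
    simp only [exitRate, if_true, one_ne_zero, if_false]
    ring
  have h1 : Tendsto (evolve q12 q21 lamS lam Φ (modeFn n 1)) atTop (𝓝 (q12 / (q12 + q21))) := by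
    have e : q12 / (q12 + q21) = 1 - q21 / (q12 + q21) := by field_simp; ring
    rw [e]
    exact (h0.const_sub 1).congr fun t => (hsum t).symm
  fin_cases m
  exacts [h0, h1]

end Evolve

/-! ### Limits of the mode-tagged accuracies -/

theorem isUnit_Wbar {q12 q21 μ lam : ℝ} (hq12 : 0 < q12) (hq21 : 0 < q21) (h : 0 < μ + lam) :
    IsUnit (Wbar q12 q21 μ lam) := by
  rw [Matrix.isUnit_iff_isUnit_det, isUnit_iff_ne_zero, Wbar, Matrix.det_fin_two_of]
  have e : (q12 + μ + lam) * (q21 + μ + lam) - q21 * q12 =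
      (μ + lam) * (q12 + q21 + (μ + lam)) := by ring
  rw [e]
  positivity

/-- If the accuracies of all sets `insert i A` with `i ∉ A` have limits `g`, those of `A` tend to the
solution `f` of the equilibrium equation. Here `μ` is the total push rate into `A` and `ν` the total
gossip rate into `A` from outside. -/
theorem tendsto_evolve_freshModeFn {q12 q21 lamS lam : ℝ}
    {Φ : (State n →ᵇ ℝ) →L[ℝ] ℝ} (hq12 : 0 < q12) (hq21 : 0 < q21) (hΦ : IsInitialLaw Φ)
    {A : Finset (Fin n)} (hA : A.Nonempty) {μ ν : ℝ} (hμ : μ = A.card * (lamS / n))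
    (hν : ν = A.card * (lam / (n - 1)) * (n - A.card)) (hpos : 0 < μ + ν) {g f : Fin 2 → ℝ}
    (hg : ∀ i ∉ A, ∀ m,
      Tendsto (evolve q12 q21 lamS lam Φ (freshModeFn (insert i A) m)) atTop (𝓝 (g m)))
    (hf : Wbar q12 q21 μ ν *ᵥ f = bvec q12 q21 μ + ν • g) (m : Fin 2) :
    Tendsto (evolve q12 q21 lamS lam Φ (freshModeFn A m)) atTop (𝓝 (f m)) := by
  have hcard : ((Aᶜ).card : ℝ) = n - A.card := by
    rw [Finset.card_compl, Fintype.card_fin, Nat.cast_sub (by simpa using A.card_le_univ)]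
  set F : Fin 2 → ℝ → ℝ := fun m t =>
    exitRate q12 q21 (1 - m) * evolve q12 q21 lamS lam Φ (modeFn n (1 - m)) t +
      μ * evolve q12 q21 lamS lam Φ (modeFn n m) t +
      A.card * (lam / (n - 1)) *
        ∑ i ∈ Aᶜ, evolve q12 q21 lamS lam Φ (freshModeFn (insert i A) m) t with hF
  have hFlim : ∀ m, Tendsto (F m) atTop (𝓝 (exitRate q12 q21 (1 - m) * statDist q12 q21 (1 - m) +
      μ * statDist q12 q21 m + ν * g m)) := by
    intro m
    have e : ν * g m = A.card * (lam / (n - 1)) * ∑ i ∈ Aᶜ, g m := by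
      rw [Finset.sum_const, nsmul_eq_mul, hcard, hν]; ring
    rw [e]
    exact (((tendsto_evolve_modeFn hq12 hq21 hΦ _).const_mul _).add
      ((tendsto_evolve_modeFn hq12 hq21 hΦ _).const_mul _)).add
      ((tendsto_finsetSum _ fun i hi => hg i (by simpa using hi) m).const_mul _)
  have hderiv : ∀ m t, HasDerivAt (evolve q12 q21 lamS lam Φ (freshModeFn A m))
      (-exitRate q12 q21 (1 - m) * evolve q12 q21 lamS lam Φ (freshModeFn A (1 - m)) t
        - (exitRate q12 q21 m + (μ + ν)) * evolve q12 q21 lamS lam Φ (freshModeFn A m) t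
        + F m t) t := by
    intro m t
    refine (hasDerivAt_evolve hΦ
      (fun x hx => generator_freshModeFn q12 q21 lamS lam hA m hx) t).congr_deriv ?_
    simp only [evolve_add, evolve_sub, evolve_smul, evolve_sum]
    simp only [Finset.sum_sub_distrib, Finset.sum_const, nsmul_eq_mul, hcard, hF, hμ, hν]
    ring
  have hf0 := congrFun hf 0
  have hf1 := congrFun hf 1
  simp only [Wbar, bvec, Matrix.mulVec, dotProduct, Fin.sum_univ_two, Matrix.of_apply,
    Matrix.cons_val_zero, Matrix.cons_val_one, Pi.add_apply, Pi.smul_apply, smul_eq_mul] at hf0 hf1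
  have key := tendsto_of_hasDerivAt_two_mode hq12 hq21 hpos
    (v₀ := evolve q12 q21 lamS lam Φ (freshModeFn A 0))
    (v₁ := evolve q12 q21 lamS lam Φ (freshModeFn A 1))
    (fun t => (hderiv 0 t).congr_deriv (by
      simp only [exitRate, sub_zero, one_ne_zero, if_true, if_false]; ring))
    (fun t => (hderiv 1 t).congr_deriv (by
      simp only [exitRate, sub_self, one_ne_zero, if_true, if_false]))
    (hFlim 0) (hFlim 1) (f₀ := f 0) (f₁ := f 1)
    (by simp only [exitRate, sub_zero, one_ne_zero, if_false]; linarith)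
    (by simp only [exitRate, sub_self, if_true]; linarith)
  fin_cases m
  exacts [key.1, key.2]

/-- The limits depend on the size of the set only: downward induction on the size `k = n - d`. The
whole network is the base case, as it receives no gossip from outside. -/
theorem exists_tendsto_evolve_freshModeFn {q12 q21 lamS lam : ℝ} (hn : 2 ≤ n) (hq12 : 0 < q12)
    (hq21 : 0 < q21) (hlamS : 0 < lamS) (hlam : 0 ≤ lam) (d : ℕ) :
    ∀ k, 1 ≤ k → k + d = n → ∃ f : Fin 2 → ℝ, ∀ Φ : (State n →ᵇ ℝ) →L[ℝ] ℝ, IsInitialLaw Φ →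
      ∀ A : Finset (Fin n), A.card = k → ∀ m,
        Tendsto (evolve q12 q21 lamS lam Φ (freshModeFn A m)) atTop (𝓝 (f m)) := by
  induction d with
  | zero =>
    intro k hk hkn
    have hpos : 0 < (k : ℝ) * (lamS / n) := by
      have : (0 : ℝ) < k := by exact_mod_cast hk
      have : (0 : ℝ) < n := by exact_mod_cast (by omega : 0 < n)
      positivity
    obtain ⟨f, hf⟩ := Matrix.mulVec_surjective_iff_isUnit.2
      (isUnit_Wbar hq12 hq21 (μ := k * (lamS / n)) (lam := 0) (by simpa using hpos))
      (bvec q12 q21 (k * (lamS / n)) + (0 : ℝ) • (0 : Fin 2 → ℝ))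
    refine ⟨f, fun Φ hΦ A hA m => tendsto_evolve_freshModeFn hq12 hq21 hΦ
      (Finset.card_pos.1 (by omega)) (by rw [hA]) ?_ (by simpa using hpos) (g := 0) ?_ hf m⟩
    · rw [hA, ← hkn]; simp
    · -- There is no set of more than `n` nodes.
      intro i hi
      have := Finset.card_le_univ (insert i A)
      rw [Finset.card_insert_of_notMem hi, Fintype.card_fin] at this
      omega
  | succ d ih =>
    intro k hk hkn
    obtain ⟨g, hg⟩ := ih (k + 1) (by omega) (by omega)
    have hk' : (0 : ℝ) < k := by exact_mod_cast hk
    have hn' : (2 : ℝ) ≤ n := by exact_mod_cast hn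
    have hkn' : (k : ℝ) ≤ n := by exact_mod_cast (by omega : k ≤ n)
    have hpos : 0 < (k : ℝ) * (lamS / n) + k * (lam / (n - 1)) * (n - k) := by
      have h1 : 0 < (k : ℝ) * (lamS / n) := by positivity
      have h2 : 0 ≤ (k : ℝ) * (lam / (n - 1)) * (n - k) :=
        mul_nonneg (mul_nonneg hk'.le (div_nonneg hlam (by linarith))) (by linarith)
      linarith
    obtain ⟨f, hf⟩ := Matrix.mulVec_surjective_iff_isUnit.2 (isUnit_Wbar hq12 hq21 hpos)
      (bvec q12 q21 (k * (lamS / n)) + (k * (lam / (n - 1)) * (n - k) : ℝ) • g)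
    exact ⟨f, fun Φ hΦ A hA m => tendsto_evolve_freshModeFn hq12 hq21 hΦ
      (Finset.card_pos.1 (by omega)) (by rw [hA]) (by rw [hA]) hpos
      (fun i hi => hg Φ hΦ _ (by rw [Finset.card_insert_of_notMem hi, hA])) hf m⟩

/-! ### From the process to its transition semigroup -/

section RandomConfigurations

variable {Ω : Type*} [MeasurableSpace Ω] {P : Measure Ω} [IsProbabilityMeasure P]

theorem integrable_comp {Y : Ω → State n} (hY : Measurable Y) (ψ : State n →ᵇ ℝ) :
    Integrable (fun ω => ψ (Y ω)) P := by
  have hψ : Measurable (ψ : State n → ℝ) := fun _ _ => trivial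
  exact Integrable.of_bound (hψ.comp hY).aestronglyMeasurable ‖ψ‖
    (ae_of_all _ fun ω => ψ.norm_coe_le_norm _)

/-- The law of a random configuration, as a functional on the bounded functions. -/
noncomputable def lawFunctional (P : Measure Ω) [IsProbabilityMeasure P] {Y : Ω → State n}
    (hY : Measurable Y) : (State n →ᵇ ℝ) →L[ℝ] ℝ :=
  LinearMap.mkContinuous
    { toFun := fun ψ => ∫ ω, ψ (Y ω) ∂P
      map_add' := fun ψ χ => integral_add (integrable_comp hY ψ) (integrable_comp hY χ)
      map_smul' := fun r ψ => integral_const_mul r _ }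
    1 fun ψ => by
      rw [one_mul]
      have h := norm_integral_le_of_norm_le_const (μ := P)
        (ae_of_all _ fun ω => ψ.norm_coe_le_norm (Y ω))
      simpa using h

theorem isInitialLaw_lawFunctional {Y : Ω → State n} (hY : Measurable Y)
    (hc : ∀ᵐ ω ∂P, (Y ω).Consistent) : IsInitialLaw (lawFunctional P hY) where
  map_one := by
    change ∫ _, (1 : ℝ) ∂P = 1
    simp
  map_eq_zero ψ hψ := by
    change ∫ ω, ψ (Y ω) ∂P = 0
    refine integral_eq_zero_of_ae ?_
    filter_upwards [hc] with ω hω using hψ _ hω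

/-- The Markov property at time `0`, integrated. -/
theorem IsGossipProcess.integral_eq_evolve {q12 q21 lamS lam : ℝ} {Z : ℝ≥0 → Ω → State n}
    (hZ : IsGossipProcess q12 q21 lamS lam P Z) (ψ : State n →ᵇ ℝ) (t : ℝ≥0) :
    ∫ ω, ψ (Z t ω) ∂P =
      evolve q12 q21 lamS lam (lawFunctional P (hZ.measurable 0)) ψ (t : ℝ) := by
  have hle : (⨆ u : Set.Iic (0 : ℝ≥0), MeasurableSpace.comap (Z u) ⊤) ≤ ‹MeasurableSpace Ω› :=
    iSup_le fun u => (hZ.measurable u).comap_le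
  have h := hZ.markov 0 t ψ
  rw [zero_add] at h
  rw [← integral_condExp hle, integral_congr_ae h]
  rfl

end RandomConfigurations

end Gossip

theorem theorem1 (n : ℕ) (hn : 2 ≤ n) (q12 q21 lamS lam : ℝ)
    (hq12 : 0 < q12) (hq21 : 0 < q21) (hlamS : 0 < lamS) (hlam : 0 ≤ lam) :
    ∃ f₂ c : Fin 2 → ℝ,
      -- `f₂` and `c` are the mode-tagged steady-state accuracies of the network
      (∀ (Ω : Type*) [MeasurableSpace Ω] (P : Measure Ω) [IsProbabilityMeasure P]
          (Z : ℝ≥0 → Ω → Gossip.State n),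
        Gossip.IsGossipProcess q12 q21 lamS lam P Z →
          (∀ A : Finset (Fin n), A.card = 2 → ∀ m : Fin 2,
            Tendsto (fun t => ∫ ω, (Z t ω).freshAccuracy A * (Z t ω).modeInd m ∂P)
              atTop (𝓝 (f₂ m))) ∧
          (∀ k : ℕ, 1 ≤ k → k ≤ n → ∀ A : Finset (Fin n), A.card = k →
            (∀ m : Fin 2,
              Tendsto (fun t => ∫ ω, (Z t ω).avgAccuracy A * (Z t ω).modeInd m ∂P)
                atTop (𝓝 (c m))) ∧
            Tendsto (fun t => ∫ ω, (Z t ω).avgAccuracy A ∂P) atTop (𝓝 (c 0 + c 1)))) ∧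
      -- `c` is the unique solution of the linear system
      Gossip.Wbar q12 q21 (lamS / n) lam *ᵥ c = Gossip.bvec q12 q21 (lamS / n) + lam • f₂ ∧
      ∀ c' : Fin 2 → ℝ,
        Gossip.Wbar q12 q21 (lamS / n) lam *ᵥ c' = Gossip.bvec q12 q21 (lamS / n) + lam • f₂ →
          c' = c := by
  obtain ⟨f₂, hf₂⟩ := Gossip.exists_tendsto_evolve_freshModeFn hn hq12 hq21 hlamS hlam (n - 2) 2
    (by omega) (by omega)
  have hn' : (2 : ℝ) ≤ n := by exact_mod_cast hn
  have hpos : 0 < lamS / n + lam := add_pos_of_pos_of_nonneg (by positivity) hlam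
  have hunit := Gossip.isUnit_Wbar hq12 hq21 hpos
  obtain ⟨c, hc⟩ := Matrix.mulVec_surjective_iff_isUnit.2 hunit
    (Gossip.bvec q12 q21 (lamS / n) + lam • f₂)
  refine ⟨f₂, c, ?_, hc, fun c' hc' =>
    Matrix.mulVec_injective_iff_isUnit.2 hunit (hc'.trans hc.symm)⟩
  intro Ω _ P _ Z hZ
  set Φ := Gossip.lawFunctional P (hZ.measurable 0)
  have hΦ : Gossip.IsInitialLaw Φ := Gossip.isInitialLaw_lawFunctional _ hZ.initial
  have hcoe : Tendsto (fun t : ℝ≥0 => (t : ℝ)) atTop atTop := NNReal.tendsto_coe_atTop.2 tendsto_id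
  -- The accuracy of a single node is `F_A` for a singleton, whose equation has push rate `lamS / n`,
  -- gossip rate `(n - 1) * (lam / (n - 1)) = lam` and forcing by sets of two nodes.
  have hnode : ∀ (i : Fin n) (m : Fin 2),
      Tendsto (fun t => ∫ ω, (Z t ω).accuracy i * (Z t ω).modeInd m ∂P) atTop (𝓝 (c m)) := by
    intro i m
    have h : Tendsto (Gossip.evolve q12 q21 lamS lam Φ (Gossip.freshModeFn {i} m)) atTop
        (𝓝 (c m)) := by
      refine Gossip.tendsto_evolve_freshModeFn hq12 hq21 hΦ (Finset.singleton_nonempty i)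
        (μ := lamS / n) (ν := lam) (by simp) ?_ hpos (g := f₂) (fun j hj => hf₂ Φ hΦ _ ?_) hc m
      · have : (n : ℝ) - 1 ≠ 0 := by linarith
        simp only [Finset.card_singleton, Nat.cast_one]
        field_simp
      · rw [Finset.card_insert_of_notMem hj, Finset.card_singleton]
    refine (h.comp hcoe).congr fun t => ?_
    rw [Function.comp_apply, ← hZ.integral_eq_evolve]
    simp only [Gossip.freshModeFn_apply, Gossip.State.freshAccuracy_singleton]
  have hint : ∀ (i : Fin n) (m : Fin 2) (t : ℝ≥0),
      Integrable (fun ω => (Z t ω).accuracy i * (Z t ω).modeInd m) P := fun i m t =>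
    (Gossip.integrable_comp (hZ.measurable t) (Gossip.freshModeFn {i} m)).congr
      (ae_of_all _ fun ω => by
        simp only [Gossip.freshModeFn_apply, Gossip.State.freshAccuracy_singleton])
  refine ⟨fun A hA m => ?_, fun k hk _ A hA => ?_⟩
  · refine ((hf₂ Φ hΦ A hA m).comp hcoe).congr fun t => ?_
    rw [Function.comp_apply, ← hZ.integral_eq_evolve]
    rfl
  have hA0 : (A.card : ℝ) ≠ 0 := by rw [hA]; exact_mod_cast (by omega : k ≠ 0)
  have hexp : ∀ (m : Fin 2) (x : Gossip.State n), x.avgAccuracy A * x.modeInd m =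
      (∑ i ∈ A, x.accuracy i * x.modeInd m) / A.card := fun m x => by
    rw [Gossip.State.avgAccuracy, div_mul_eq_mul_div, Finset.sum_mul]
  have hintA : ∀ (m : Fin 2) (t : ℝ≥0),
      Integrable (fun ω => (Z t ω).avgAccuracy A * (Z t ω).modeInd m) P := fun m t => by
    simp only [hexp]
    exact (integrable_finsetSum _ fun i _ => hint i m t).div_const _
  have hmode : ∀ m : Fin 2,
      Tendsto (fun t => ∫ ω, (Z t ω).avgAccuracy A * (Z t ω).modeInd m ∂P) atTop (𝓝 (c m)) := by
    intro m
    have hlim := (tendsto_finsetSum A fun i _ => hnode i m).div_const (A.card : ℝ)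
    rw [Finset.sum_const, nsmul_eq_mul, mul_div_cancel_left₀ _ hA0] at hlim
    refine hlim.congr fun t => ?_
    simp only [hexp]
    rw [integral_div, integral_finsetSum _ fun i _ => hint i m t]
  refine ⟨hmode, ((hmode 0).add (hmode 1)).congr fun t => ?_⟩
  rw [← integral_add (hintA 0 t) (hintA 1 t)]
  congr 1 with ω
  have h : (Z t ω).modeInd 0 + (Z t ω).modeInd 1 = 1 :=
    congrArg (fun ψ : Gossip.State n →ᵇ ℝ => ψ (Z t ω)) Gossip.modeFn_zero_add_one
  rw [← mul_add, h, mul_one]
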